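/- **Theorem (Bianchi identity).** Let $G$ be a (finite-dimensional, real) Lie group with Lie algebra $\mathfrak g=T_1G$ and let $\pi:P\to M$ be a smooth principal $G$-bundle over a smooth manifold $M$ (finite-dimensional, without boundary), with principal right action $\rho_g(p)=p\cdot g$. For $Z\in\mathfrak g$ write $Z_P(p)=\zeta_p(Z)$ for the infinitesimal action, where $\zeta_p=T_1(g\mapsto p\cdot g):\mathfrak g\to T_pP$. Let $\omega\in\Omega^1(P,\mathfrak g)$ be a principal connection, i.e. a smooth $\mathfrak g$-valued $1$-form with $\omega(Z_P)=Z$ for all $Z\in\mathfrak g$ and $\omega\circ T\rho_g=\mathrm{Ad}(g^{-1})\circ\omega$ for all $g\in G$. Let $P_V=\zeta\circ\omega$ and $P_H=\mathrm{id}-P_V$ be the vertical and horizontal projections of $TP$, and for a differential form $\alpha$ on $P$ of degree $k$ with values in a vector space let $$(d^\omega\alpha)(v_0,\dots,v_k)=(d\alpha)(P_Hv_0,\dots,P_Hv_k)$$ be its exterior covariant derivative. Then there is exactly one smooth $2$-form $\Omega^\omega\in\Omega^2(P,\mathfrak g)$, the curvature form of $\omega$, such that $$\zeta\bigl(\Omega^\omega(X,Y)\bigr)=-P_V\bigl([P_HX,P_HY]\bigr)$$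 for all smooth vector fields $X,Y$ on open subsets of $P$, and it satisfies $$d^\omega\Omega^\omega=0 .$$ -/

import Mathlib

open Set
open scoped Manifold ContDiff Topology

noncomputable section

/-- A (not necessarily smooth) `W`-valued differential `k`-form on the manifold `P`: at every point
`p` an alternating `k`-linear map on the tangent space `T_p P`. -/
abbrev DForm {E H : Type*} [NormedAddCommGroup E] [NormedSpace ℝ E] [TopologicalSpace H]
    (I : ModelWithCorners ℝ E H) (P : Type*) [TopologicalSpace P] [ChartedSpace H P]
    (k : ℕ) (W : Type*) [NormedAddCommGroup W] [NormedSpace ℝ W] :=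
  (p : P) → TangentSpace I p [⋀^Fin k]→L[ℝ] W

namespace DForm

variable {E H : Type*} [NormedAddCommGroup E] [NormedSpace ℝ E] [TopologicalSpace H]
  {I : ModelWithCorners ℝ E H} {P : Type*} [TopologicalSpace P] [ChartedSpace H P]
  {k : ℕ} {W : Type*} [NormedAddCommGroup W] [NormedSpace ℝ W]

/-- The expression of a form in the chart `φ` around `p₀`: the pullback of the form along
`φ⁻¹`, a differential form on the model vector space `E` (meaningful on the target of `φ`). -/
def inChart (α : DForm I P k W) (p₀ : P) (y : E) : E [⋀^Fin k]→L[ℝ] W :=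
  (α ((extChartAt I p₀).symm y)).compContinuousLinearMap
    (mfderivWithin 𝓘(ℝ, E) I (extChartAt I p₀).symm (range I) y)

/-- A form is smooth if its expressions in charts are smooth. -/
def IsSmooth (α : DForm I P k W) : Prop :=
  ∀ p₀ : P, ContDiffOn ℝ ∞ (α.inChart p₀) (extChartAt I p₀).target

/-- The exterior derivative `d` of a form. At `p` it is computed in the chart `φ` around `p`:
`(dα)_p = φ^* (d ((φ⁻¹)^* α))_{φ(p)}`. -/
def extDer (α : DForm I P k W) : DForm I P (k + 1) W := fun p ↦
  (extDerivWithin (α.inChart p) (range I) (extChartAt I p p)).compContinuousLinearMap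
    (mfderiv I 𝓘(ℝ, E) (extChartAt I p) p)

/-- A `1`-form at `p`, as a linear map on `T_p P`. -/
def toLin (α : DForm I P 1 W) (p : P) : TangentSpace I p →L[ℝ] W :=
  (ContinuousAlternatingMap.ofSubsingleton ℝ (TangentSpace I p) W (0 : Fin 1)).symm (α p)

end DForm

/-- A smooth principal `G`-bundle structure with total space `P` and base space `M`: a smooth map
`π : P → M` and a smooth right action of `G` on `P` preserving the fibres of `π`, such that `M` is
covered by the base sets of `G`-equivariant smooth local trivialisations
`ψ : π⁻¹(U) ≅ U × G` (with `G` acting on `U × G` by right multiplication on the second factor). -/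
structure PrincipalBundle
    {E H : Type*} [NormedAddCommGroup E] [NormedSpace ℝ E] [TopologicalSpace H]
    (I : ModelWithCorners ℝ E H) (P : Type*) [TopologicalSpace P] [ChartedSpace H P]
    {EM HM : Type*} [NormedAddCommGroup EM] [NormedSpace ℝ EM] [TopologicalSpace HM]
    (IM : ModelWithCorners ℝ EM HM) (M : Type*) [TopologicalSpace M] [ChartedSpace HM M]
    {EG HG : Type*} [NormedAddCommGroup EG] [NormedSpace ℝ EG] [TopologicalSpace HG]
    (IG : ModelWithCorners ℝ EG HG) (G : Type*) [TopologicalSpace G] [ChartedSpace HG G]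
    [Group G] where
  /-- the bundle projection -/
  proj : P → M
  /-- the principal right action -/
  act : P → G → P
  act_one : ∀ p, act p 1 = p
  act_mul : ∀ p g h, act p (g * h) = act (act p g) h
  contMDiff_proj : ContMDiff I IM ∞ proj
  contMDiff_act : ContMDiff (I.prod IG) I ∞ (fun x : P × G ↦ act x.1 x.2)
  proj_act : ∀ p g, proj (act p g) = proj p
  exists_trivialization : ∀ m : M, ∃ ψ : Bundle.Trivialization G proj, m ∈ ψ.baseSet ∧
    ContMDiffOn I (IM.prod IG) ∞ ψ ψ.source ∧
    ContMDiffOn (IM.prod IG) I ∞ ψ.toOpenPartialHomeomorph.symm ψ.target ∧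
    ∀ p ∈ ψ.source, ∀ g : G, ψ (act p g) = ((ψ p).1, (ψ p).2 * g)

/-- The adjoint representation `Ad(g) = T_1 (h ↦ g h g⁻¹)` of `G` on its Lie algebra `T_1 G`.
(Mathlib's `TangentSpace IG (1 : G)`, i.e. `GroupLieAlgebra IG G`, is by definition the model vector
space `EG`; as a normed space the Lie algebra is therefore written `EG`.) -/
def lieAd {EG HG : Type*} [NormedAddCommGroup EG] [NormedSpace ℝ EG] [TopologicalSpace HG]
    (IG : ModelWithCorners ℝ EG HG) {G : Type*} [TopologicalSpace G] [ChartedSpace HG G]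
    [Group G] (g : G) : EG →L[ℝ] EG :=
  (mfderiv IG IG (fun h : G ↦ g * h * g⁻¹) 1 : GroupLieAlgebra IG G →L[ℝ] _)

namespace PrincipalBundle

variable {E H : Type*} [NormedAddCommGroup E] [NormedSpace ℝ E] [TopologicalSpace H]
  {I : ModelWithCorners ℝ E H} {P : Type*} [TopologicalSpace P] [ChartedSpace H P]
  {EM HM : Type*} [NormedAddCommGroup EM] [NormedSpace ℝ EM] [TopologicalSpace HM]
  {IM : ModelWithCorners ℝ EM HM} {M : Type*} [TopologicalSpace M] [ChartedSpace HM M]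
  {EG HG : Type*} [NormedAddCommGroup EG] [NormedSpace ℝ EG] [TopologicalSpace HG]
  {IG : ModelWithCorners ℝ EG HG} {G : Type*} [TopologicalSpace G] [ChartedSpace HG G]
  [Group G]
  {k : ℕ} {W : Type*} [NormedAddCommGroup W] [NormedSpace ℝ W]

/-- The infinitesimal action `ζ_p : 𝔤 → T_p P`, `Z ↦ Z_P(p) = T_1 (g ↦ p ⬝ g) (Z)`
(recall that `p ⬝ 1 = p`). -/
def fundamental (B : PrincipalBundle I P IM M IG G) (p : P) : EG →L[ℝ] TangentSpace I p :=
  (mfderiv IG I (B.act p) 1 : GroupLieAlgebra IG G →L[ℝ] TangentSpace I (B.act p 1))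

/-- `η ∈ Ω¹(P, 𝔤)` is (the connection form of) a principal connection: it is smooth, it reproduces
the generators of the infinitesimal action, `η(Z_P) = Z`, and it is `G`-equivariant,
`η(Tρ_g (v)) = Ad(g⁻¹) (η(v))`. -/
structure IsPrincipalConnection (B : PrincipalBundle I P IM M IG G) (η : DForm I P 1 EG) :
    Prop where
  smooth : η.IsSmooth
  reproduces : ∀ (p : P) (Z : EG), η.toLin p (B.fundamental p Z) = Z
  equivariant : ∀ (g : G) (p : P) (v : TangentSpace I p),
    η.toLin (B.act p g) (mfderiv I I (fun q ↦ B.act q g) p v) = lieAd IG g⁻¹ (η.toLin p v)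

/-- The vertical projection `P_V = ζ ∘ η`. -/
def vertProj (B : PrincipalBundle I P IM M IG G) (η : DForm I P 1 EG) (p : P) :
    TangentSpace I p →L[ℝ] TangentSpace I p :=
  (B.fundamental p).comp (η.toLin p)

/-- The horizontal projection `P_H = id - P_V`. -/
def horProj (B : PrincipalBundle I P IM M IG G) (η : DForm I P 1 EG) (p : P) :
    TangentSpace I p →L[ℝ] TangentSpace I p :=
  ContinuousLinearMap.id ℝ (TangentSpace I p) - B.vertProj η p

/-- The exterior covariant derivative `d^η = P_H^* ∘ d`, i.e.
`(d^η α)(v₀, …, v_k) = (dα)(P_H v₀, …, P_H v_k)`. -/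
def covExtDer (B : PrincipalBundle I P IM M IG G) (η : DForm I P 1 EG) (α : DForm I P k W) :
    DForm I P (k + 1) W := fun p ↦
  (α.extDer p).compContinuousLinearMap (B.horProj η p)

/-- `Ω` is the curvature form of the connection `η`: it is the smooth `𝔤`-valued `2`-form with
`ζ(Ω(X, Y)) = R(X, Y)`, where `R(X, Y) = -P_V [P_H X, P_H Y]` for (locally defined) smooth
vector fields `X`, `Y` on `P`. -/
def IsCurvatureForm [IsManifold I ∞ P] (B : PrincipalBundle I P IM M IG G) (η : DForm I P 1 EG)
    (Ω : DForm I P 2 EG) : Prop :=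
  Ω.IsSmooth ∧ ∀ U : Set P, IsOpen U → ∀ X Y : (p : P) → TangentSpace I p,
    ContMDiffOn I I.tangent ∞ (fun p ↦ (⟨p, X p⟩ : TangentBundle I P)) U →
    ContMDiffOn I I.tangent ∞ (fun p ↦ (⟨p, Y p⟩ : TangentBundle I P)) U →
    ∀ p ∈ U, B.fundamental p (Ω p ![X p, Y p]) =
      -B.vertProj η p (VectorField.mlieBracket I
        (fun q ↦ B.horProj η q (X q)) (fun q ↦ B.horProj η q (Y q)) p)

end PrincipalBundle

end

/-! The curvature form is `d^η η`. Since `η` vanishes on horizontal fields, the two derivative terms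
of `dη(P_H X, P_H Y)` combine to `-η([P_H X, P_H Y])` (`extDeriv_eq_neg_lieBracket_of_ker`);
applying `ζ` gives the defining property. Uniqueness: `η` is a left inverse of `ζ`, and tangent
vectors extend to local smooth fields.

For the Bianchi identity write the curvature as `h^* Θ` with `Θ = dη` closed and `h = P_H`. On
horizontal vectors, `d(h^* Θ)` is `dΘ = 0` plus terms in which one slot of `Θ` holds a derivative of
`h`. Differentiating `h ∘ h = h` shows that this slot is vertical while the other is horizontal
(`extDeriv_compContinuousLinearMap_projection_eq_zero`), so it suffices that `dη(vertical,
horizontal) = 0`. This is infinitesimal equivariance: pull `η` back along the action `P × G → P`;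
both functions differentiated in `d` are then constant (`extDeriv_orbit_eq_zero`). Neither the
structure equation nor the bracket of `𝔤` is needed.

All of this is calculus in one chart, where every tangent space becomes the model space;
`inChart_extDer` makes `d` independent of the chart. -/

open Set
open scoped Manifold ContDiff Topology

noncomputable section

/-! ### Smoothness of pullbacks of alternating maps -/

section AlternatingSmooth

variable {𝕜 ι E F V W : Type*} [NontriviallyNormedField 𝕜] [Fintype ι]
  [NormedAddCommGroup E] [NormedSpace 𝕜 E] [NormedAddCommGroup F] [NormedSpace 𝕜 F]
  [NormedAddCommGroup V] [NormedSpace 𝕜 V] [NormedAddCommGroup W] [NormedSpace 𝕜 W]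

/-- Alternatization as a continuous linear map. -/
def ContinuousMultilinearMap.alternatizationCLM [DecidableEq ι] :
    ContinuousMultilinearMap 𝕜 (fun _ : ι ↦ V) W →L[𝕜] V [⋀^ι]→L[𝕜] W :=
  LinearMap.mkContinuous
    { toFun := ContinuousMultilinearMap.alternatization
      map_add' := map_add _
      map_smul' := fun c f ↦ by
        ext v
        simp [ContinuousMultilinearMap.alternatization_apply_apply, Finset.smul_sum,
          smul_comm c] }
    (Fintype.card (Equiv.Perm ι)) <| fun f ↦ by
      refine ContinuousAlternatingMap.opNorm_le_bound _ (by positivity) fun v ↦ ?_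
      simp only [LinearMap.coe_mk, AddHom.coe_mk,
        ContinuousMultilinearMap.alternatization_apply_apply]
      refine (norm_sum_le _ _).trans ?_
      rw [mul_assoc, ← nsmul_eq_mul]
      refine Finset.sum_le_card_nsmul _ _ _ fun σ _ ↦ ?_
      have h : ‖Equiv.Perm.sign σ • f (v ∘ σ)‖ = ‖f (v ∘ σ)‖ := by
        rcases Int.units_eq_one_or (Equiv.Perm.sign σ) with h | h <;> simp [h]
      rw [h]
      refine (f.le_opNorm _).trans_eq ?_
      simp only [Function.comp_apply]
      rw [Equiv.prod_comp σ fun i ↦ ‖v i‖]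

/-- In each summand the sign of the permutation cancels the sign produced by permuting the
arguments. Dividing by the factorial therefore recovers an alternating map linearly and continuously
from its multilinear map. -/
theorem ContinuousMultilinearMap.alternatizationCLM_toContinuousMultilinearMap [DecidableEq ι]
    (f : V [⋀^ι]→L[𝕜] W) :
    ContinuousMultilinearMap.alternatizationCLM f.toContinuousMultilinearMap
      = (Fintype.card ι).factorial • f := by
  ext v
  change ContinuousMultilinearMap.alternatization f.toContinuousMultilinearMap v = _
  rw [ContinuousMultilinearMap.alternatization_apply_apply]
  have h (σ : Equiv.Perm ι) :
      Equiv.Perm.sign σ • f.toContinuousMultilinearMap (v ∘ σ) = f v := by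
    have := f.toAlternatingMap.map_perm v σ
    simp only [ContinuousAlternatingMap.coe_toAlternatingMap] at this
    change Equiv.Perm.sign σ • f (v ∘ σ) = f v
    rw [this, smul_smul]
    simp
  simp only [h, Finset.sum_const, Finset.card_univ, Fintype.card_perm]
  simp

variable [CharZero 𝕜]

/-- For multilinear maps, composition is multilinear in the inner maps and linear in the outer one,
hence smooth. Normalised alternatization carries this back to alternating maps. -/
theorem ContDiffWithinAt.continuousAlternatingMap_compContinuousLinearMap {n : ℕ∞ω}
    {f : E → F [⋀^ι]→L[𝕜] W} {g : E → V →L[𝕜] F} {s : Set E} {x : E}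
    (hf : ContDiffWithinAt 𝕜 n f s x) (hg : ContDiffWithinAt 𝕜 n g s x) :
    ContDiffWithinAt 𝕜 n (fun y ↦ (f y).compContinuousLinearMap (g y)) s x := by
  classical
  have h1 : ContDiffWithinAt 𝕜 n (fun y ↦
      ContinuousMultilinearMap.compContinuousLinearMapContinuousMultilinear 𝕜
        (fun _ : ι ↦ V) (fun _ ↦ F) W (fun _ ↦ g y)) s x :=
    (ContinuousMultilinearMap.contDiff _).contDiffAt.comp_contDiffWithinAt x
      (contDiffWithinAt_pi.2 fun _ ↦ hg)
  have h2 : ContDiffWithinAt 𝕜 n (fun y ↦ (f y).toContinuousMultilinearMap) s x :=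
    (ContinuousAlternatingMap.toContinuousMultilinearMapCLM 𝕜 :
      F [⋀^ι]→L[𝕜] W →L[𝕜] _).contDiff.contDiffAt.comp_contDiffWithinAt x hf
  have h3 := ((ContinuousMultilinearMap.alternatizationCLM (𝕜 := 𝕜) (ι := ι) (V := V)
    (W := W)).contDiff (n := n)).contDiffAt.comp_contDiffWithinAt x (h1.clm_apply h2)
  have h4 := h3.const_smul ((Fintype.card ι).factorial : 𝕜)⁻¹
  refine h4.congr_of_eventuallyEq (Filter.Eventually.of_forall fun y ↦ ?_) ?_
  all_goals
    have hne : ((Fintype.card ι).factorial : 𝕜) ≠ 0 := by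
      exact_mod_cast Nat.factorial_ne_zero _
    simp only [Function.comp_apply]
    rw [eq_inv_smul_iff₀ hne, Nat.cast_smul_eq_nsmul,
      ← ContinuousMultilinearMap.alternatizationCLM_toContinuousMultilinearMap]
    rfl

theorem ContDiffOn.continuousAlternatingMap_compContinuousLinearMap {n : ℕ∞ω}
    {f : E → F [⋀^ι]→L[𝕜] W} {g : E → V →L[𝕜] F} {s : Set E}
    (hf : ContDiffOn 𝕜 n f s) (hg : ContDiffOn 𝕜 n g s) :
    ContDiffOn 𝕜 n (fun y ↦ (f y).compContinuousLinearMap (g y)) s := fun x hx ↦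
  (hf x hx).continuousAlternatingMap_compContinuousLinearMap (hg x hx)

end AlternatingSmooth

/-! ### Exterior calculus on a vector space -/

section VectorSpace

variable {E F W : Type*} [NormedAddCommGroup E] [NormedSpace ℝ E]
  [NormedAddCommGroup F] [NormedSpace ℝ F] [NormedAddCommGroup W] [NormedSpace ℝ W]

theorem contDiffOn_extDeriv {k : ℕ} {α : E → E [⋀^Fin k]→L[ℝ] W} {s : Set E} (hs : IsOpen s)
    (hα : ContDiffOn ℝ ∞ α s) : ContDiffOn ℝ ∞ (extDeriv α) s :=
  (ContinuousAlternatingMap.alternatizeUncurryFinCLM ℝ E W).contDiff.comp_contDiffOn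
    (hα.fderiv_of_isOpen hs (by simp))

/-- Let `Θ` be a closed form and `h` a field of projections. If `Θ` vanishes as soon as one argument
lies in the kernel of `h` and the others in its range, then `h^* d (h^* Θ) = 0`. -/
theorem extDeriv_compContinuousLinearMap_projection_eq_zero {k : ℕ}
    {Θ : E → E [⋀^Fin k]→L[ℝ] W} {h : E → E →L[ℝ] E} {y : E}
    (hΘ : DifferentiableAt ℝ Θ y) (hh : DifferentiableAt ℝ h y) (hd : extDeriv Θ y = 0)
    (hproj : ∀ᶠ x in 𝓝 y, ∀ v, h x (h x v) = h x v)
    (hvan : ∀ (i : Fin k) (w : Fin k → E), h y (w i) = 0 → (∀ j ≠ i, h y (w j) = w j) →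
      Θ y w = 0) :
    (extDeriv (fun x ↦ (Θ x).compContinuousLinearMap (h x)) y).compContinuousLinearMap (h y)
      = 0 := by
  have hy : ∀ v, h y (h y v) = h y v := hproj.self_of_nhds
  -- The product rule for `h ∘ h = h` in direction `u` gives `(D_u h)(h v) + h (D_u h v) = D_u h v`;
  -- for `h v = v` the first term cancels the right-hand side.
  have hD : ∀ u v, h y v = v → h y (fderiv ℝ h y u v) = 0 := by
    intro u v hv
    have h1 : HasFDerivAt (fun x ↦ h x (h x v)) _ y :=
      hh.hasFDerivAt.clm_apply (hh.hasFDerivAt.clm_apply (hasFDerivAt_const v y))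
    have h2 : HasFDerivAt (fun x ↦ h x v) _ y := hh.hasFDerivAt.clm_apply (hasFDerivAt_const v y)
    have h3 := h1.unique (h2.congr_of_eventuallyEq (hproj.mono fun x hx ↦ hx v))
    have h4 := congrArg (fun L : E →L[ℝ] E ↦ L u) h3
    simp [hv] at h4
    exact h4
  ext v
  have key := congrArg (fun τ ↦ τ (fun i ↦ h y (v i))) hd
  simp only [extDeriv, ContinuousAlternatingMap.alternatizeUncurryFin_apply,
    ContinuousAlternatingMap.compContinuousLinearMap_apply,
    fderiv_continuousAlternatingMapCompContinuousLinearMap hΘ hh] at key ⊢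
  change _ = (0 : W) at key
  change _ = (0 : W)
  rw [← key]
  simp only [Function.comp_def]
  refine Finset.sum_congr rfl fun i _ ↦ ?_
  congr 1
  have e : ∀ j, h y (i.removeNth (fun i ↦ h y (v i)) j) = i.removeNth (fun i ↦ h y (v i)) j :=
    fun j ↦ hy _
  simp only [add_apply, ContinuousLinearMap.comp_apply,
    ContinuousAlternatingMap.add_apply,
    ContinuousAlternatingMap.fderivCompContinuousLinearMap_apply]
  -- The sum collects the terms with `h` differentiated in one slot: by `hD` that slot lies in `ker
  -- h`, the others in its range, so `hvan` applies.
  rw [Finset.sum_eq_zero, add_zero]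
  · change (fderiv ℝ Θ y (h y (v i))) (fun j ↦ h y (i.removeNth (fun i ↦ h y (v i)) j)) = _
    simp only [e]
  · intro j _
    refine hvan j _ ?_ fun l hl ↦ ?_
    · simp only [Function.update_self]
      exact hD _ _ (e j)
    · simp only [Function.update_of_ne hl, e]

theorem extDeriv_apply_two {α : E → E [⋀^Fin 1]→L[ℝ] W} {y : E} (hα : DifferentiableAt ℝ α y)
    (u v : E) :
    extDeriv α y ![u, v] = fderiv ℝ (α · ![v]) y u - fderiv ℝ (α · ![u]) y v := by
  rw [extDeriv_apply hα, Fin.sum_univ_two]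
  have h0 : (0 : Fin 2).removeNth ![u, v] = ![v] := by ext i; fin_cases i; rfl
  have h1 : (1 : Fin 2).removeNth ![u, v] = ![u] := by ext i; fin_cases i; rfl
  simp [h0, h1, sub_eq_add_neg]

/-- If `X` and `Y` lie in the kernel of the `1`-form `α`, then `dα(X, Y) = -α([X, Y])`. -/
theorem extDeriv_eq_neg_lieBracket_of_ker {α : E → E [⋀^Fin 1]→L[ℝ] W} {X Y : E → E} {y : E}
    (hα : DifferentiableAt ℝ α y) (hX : DifferentiableAt ℝ X y) (hY : DifferentiableAt ℝ Y y)
    (hαX : ∀ᶠ x in 𝓝 y, α x ![X x] = 0) (hαY : ∀ᶠ x in 𝓝 y, α x ![Y x] = 0) :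
    extDeriv α y ![X y, Y y] = -α y ![VectorField.lieBracket ℝ X Y y] := by
  let a : E → E →L[ℝ] W := fun x ↦
    (ContinuousAlternatingMap.ofSubsingletonLIE (𝕜 := ℝ) (E := E) (F := W) (0 : Fin 1)).symm (α x)
  have ha : DifferentiableAt ℝ a y :=
    (ContinuousAlternatingMap.ofSubsingletonLIE (𝕜 := ℝ) (E := E) (F := W)
      (0 : Fin 1)).symm.toContinuousLinearEquiv.toContinuousLinearMap.differentiableAt.comp y hα
  have haα : ∀ x v, α x ![v] = a x v := by
    intro x v
    change α x ![v] = α x (fun _ ↦ v)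
    congr 1
    ext i; fin_cases i; rfl
  -- Product rule for the locally vanishing function `a(Z)`: the derivative moves from the form to
  -- the field, which turns `dα(X, Y)` into the bracket.
  have hderiv : ∀ Z : E → E, DifferentiableAt ℝ Z y → (∀ᶠ x in 𝓝 y, α x ![Z x] = 0) → ∀ u,
      fderiv ℝ a y u (Z y) = - a y (fderiv ℝ Z y u) := by
    intro Z hZ hz u
    have h1 : HasFDerivAt (fun x ↦ a x (Z x)) _ y := ha.hasFDerivAt.clm_apply hZ.hasFDerivAt
    have h2 := h1.unique ((hasFDerivAt_const (0 : W) y).congr_of_eventuallyEq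
      (hz.mono fun x hx ↦ (haα x (Z x)).symm.trans hx))
    have h3 := congrArg (fun L : E →L[ℝ] W ↦ L u) h2
    simp at h3
    rw [eq_neg_iff_add_eq_zero, add_comm]
    exact h3
  have hc : ∀ u v, fderiv ℝ (α · ![v]) y u = fderiv ℝ a y u v := by
    intro u v
    simp only [haα]
    rw [fderiv_clm_apply ha (differentiableAt_const v)]
    simp
  rw [extDeriv_apply_two hα, hc, hc, hderiv X hX hαX, hderiv Y hY hαY, haα]
  simp [VectorField.lieBracket, sub_eq_add_neg, add_comm]

/-- Infinitesimal equivariance: let `A : E × F → E` be a local action such that `α` restricts to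
a constant along the orbit directions and such that `v` stays in the kernel of `α` along the action.
Then `dα` vanishes on the orbit direction and `v`. -/
theorem extDeriv_orbit_eq_zero {α : E → E [⋀^Fin 1]→L[ℝ] W} {A : E × F → E} {y : E} {z : F}
    {v : E} {Z : F} {c : W}
    (hα : DifferentiableAt ℝ α y) (hA : ContDiffAt ℝ ∞ A (y, z))
    (hid : ∀ᶠ x in 𝓝 y, A (x, z) = x)
    (horbit : ∀ᶠ x in 𝓝 y, α x ![fderiv ℝ A (x, z) (0, Z)] = c)
    (hequi : ∀ᶠ w in 𝓝 z, α (A (y, w)) ![fderiv ℝ A (y, w) (v, 0)] = 0) :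
    extDeriv α y ![fderiv ℝ A (y, z) (0, Z), v] = 0 := by
  have hAyz : A (y, z) = y := hid.self_of_nhds
  have hAd : DifferentiableAt ℝ A (y, z) := hA.differentiableAt (by simp)
  have hfd : DifferentiableAt ℝ (fderiv ℝ A) (y, z) :=
    (hA.fderiv_right (m := 1) (by norm_cast)).differentiableAt one_ne_zero
  have hα' : DifferentiableAt ℝ α (A (y, z)) := by rwa [hAyz]
  have hβ : DifferentiableAt ℝ
      (fun q ↦ (α (A q)).compContinuousLinearMap (fderiv ℝ A q)) (y, z) :=
    (hα'.comp (y, z) hAd).continuousAlternatingMapCompContinuousLinearMap hfd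
  have hcurve : fderiv ℝ A (y, z) (v, 0) = v := by
    have h1 : HasFDerivAt (fun x ↦ A (x, z)) _ y :=
      hAd.hasFDerivAt.comp y (hasFDerivAt_prodMk_left y z)
    have h2 := h1.unique ((hasFDerivAt_id y).congr_of_eventuallyEq hid)
    simpa using congrArg (fun L : E →L[ℝ] E ↦ L v) h2
  -- By naturality, `d(A^* α)` may be evaluated on the product instead. There `(0, Z)` and `(v, 0)`
  -- extend to constant fields, so only two directional derivatives remain, and `e1`, `e2` kill
  -- them.
  have hpull := congrArg (fun τ ↦ τ ![((0 : E), Z), (v, (0 : F))])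
    (extDeriv_pullback hα' (hA.of_le (by norm_cast)) (by simp) (r := 2))
  simp only [ContinuousAlternatingMap.compContinuousLinearMap_apply, hAyz] at hpull
  have hvec : (⇑(fderiv ℝ A (y, z)) ∘ ![((0 : E), Z), (v, (0 : F))])
      = ![fderiv ℝ A (y, z) (0, Z), v] := by
    ext i; fin_cases i
    · rfl
    · exact hcurve
  rw [hvec] at hpull
  rw [← hpull, extDeriv_apply_two hβ]
  have hone : ∀ (q u : E × F), ((α (A q)).compContinuousLinearMap (fderiv ℝ A q)) ![u]
      = α (A q) ![fderiv ℝ A q u] := by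
    intro q u
    rw [ContinuousAlternatingMap.compContinuousLinearMap_apply]
    congr 1
    ext i; fin_cases i; rfl
  have hβu : ∀ u : E × F, DifferentiableAt ℝ
      (fun q ↦ ((α (A q)).compContinuousLinearMap (fderiv ℝ A q)) ![u]) (y, z) := fun u ↦
    hβ.continuousAlternatingMap_apply_const _
  have e1 : fderiv ℝ (fun q ↦ ((α (A q)).compContinuousLinearMap (fderiv ℝ A q)) ![(v, (0 : F))])
      (y, z) (0, Z) = 0 := by
    have h1 := (hβu (v, 0)).hasFDerivAt.comp (f := fun e ↦ (y, e)) z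
      (hasFDerivAt_prodMk_right y z)
    have h2 := h1.unique ((hasFDerivAt_const (0 : W) z).congr_of_eventuallyEq
      (hequi.mono fun w hw ↦ by simpa [hone] using hw))
    simpa using congrArg (fun L : F →L[ℝ] W ↦ L Z) h2
  have e2 : fderiv ℝ (fun q ↦ ((α (A q)).compContinuousLinearMap (fderiv ℝ A q)) ![((0 : E), Z)])
      (y, z) (v, 0) = 0 := by
    have h1 := (hβu (0, Z)).hasFDerivAt.comp (f := fun e ↦ (e, z)) y
      (hasFDerivAt_prodMk_left y z)
    have h2 := h1.unique ((hasFDerivAt_const c y).congr_of_eventuallyEq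
      ((hid.and horbit).mono fun x hx ↦ by simpa [hone, hx.1] using hx.2))
    simpa using congrArg (fun L : E →L[ℝ] W ↦ L v) h2
  rw [e1, e2, sub_zero]

end VectorSpace

/-! ### Derivatives of charts -/

section Chart

variable {E H : Type*} [NormedAddCommGroup E] [NormedSpace ℝ E] [TopologicalSpace H]
  {I : ModelWithCorners ℝ E H} {P : Type*} [TopologicalSpace P] [ChartedSpace H P]

variable (I) in
/-- The derivative of the chart around `p₀`, as an endomorphism of the model space. -/
def chartDeriv (p₀ q : P) : E →L[ℝ] E := mfderiv I 𝓘(ℝ, E) (extChartAt I p₀) q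

variable (I) in
/-- The derivative of the inverse of the chart around `p₀`, as an endomorphism of the model
space. -/
def chartSymmDeriv (p₀ : P) (y : E) : E →L[ℝ] E :=
  mfderivWithin 𝓘(ℝ, E) I (extChartAt I p₀).symm (range I) y

theorem chartSymmDeriv_eq_mfderiv [I.Boundaryless] (p₀ : P) (y : E) :
    chartSymmDeriv I p₀ y = mfderiv 𝓘(ℝ, E) I (extChartAt I p₀).symm y := by
  unfold chartSymmDeriv
  rw [I.range_eq_univ, mfderivWithin_univ]

variable [IsManifold I 1 P]

/-- The preferred chart at `p` is the one identifying `T_p P` with the model space, so its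
derivative there is the identity. -/
theorem chartSymmDeriv_self (p : P) (v : E) :
    chartSymmDeriv I p (extChartAt I p p) v = v := by
  unfold chartSymmDeriv
  rw [mfderivWithin_range_extChartAt_symm]
  rfl

theorem chartDeriv_self (p : P) (v : E) : chartDeriv I p p v = v := by
  unfold chartDeriv
  rw [mfderiv_extChartAt_self]
  rfl

theorem chartSymmDeriv_chartDeriv {p₀ : P} {y : E} (hy : y ∈ (extChartAt I p₀).target) (v : E) :
    chartSymmDeriv I p₀ y (chartDeriv I p₀ ((extChartAt I p₀).symm y) v) = v :=
  congrArg (fun L : E →L[ℝ] E ↦ L v) (mfderivWithin_extChartAt_symm_comp_mfderiv_extChartAt hy)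

end Chart

/-! ### Forms in charts and chart independence of `d` -/

namespace DForm

variable {E H : Type*} [NormedAddCommGroup E] [NormedSpace ℝ E] [TopologicalSpace H]
  {I : ModelWithCorners ℝ E H} {P : Type*} [TopologicalSpace P] [ChartedSpace H P]
  {k : ℕ} {W : Type*} [NormedAddCommGroup W] [NormedSpace ℝ W]

/-- The value of a form on vectors of the model space, without dependence of the type on the
point. -/
def eval (α : DForm I P k W) (p : P) (v : Fin k → E) : W := α p v

theorem inChart_eval (α : DForm I P k W) (p₀ : P) (y : E) (v : Fin k → E) :
    α.inChart p₀ y v =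
      α.eval ((extChartAt I p₀).symm y) (fun i ↦ chartSymmDeriv I p₀ y (v i)) := rfl

theorem extDer_eval [I.Boundaryless] (α : DForm I P k W) (p : P) (v : Fin (k + 1) → E) :
    α.extDer.eval p v =
      extDeriv (α.inChart p) (extChartAt I p p) (fun i ↦ chartDeriv I p p (v i)) := by
  rw [← extDerivWithin_univ, ← I.range_eq_univ]
  rfl

theorem toLin_eval (α : DForm I P 1 W) (p : P) (v : E) : α.toLin p v = α.eval p ![v] := by
  change α p (fun _ ↦ v) = α p ![v]
  congr 1
  ext i; fin_cases i; rfl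

theorem inChart_self_eval [IsManifold I 1 P] (α : DForm I P k W) (p : P) (v : Fin k → E) :
    α.inChart p (extChartAt I p p) v = α.eval p v := by
  rw [inChart_eval, extChartAt_to_inv]
  congr 1
  ext i
  exact chartSymmDeriv_self p (v i)

/-- A `1`-form in the chart around `p₀`, as a field of linear maps. -/
def linInChart (α : DForm I P 1 W) (p₀ : P) (y : E) : E →L[ℝ] W :=
  (ContinuousAlternatingMap.ofSubsingletonLIE (𝕜 := ℝ) (E := E) (F := W) (0 : Fin 1)).symm
    (α.inChart p₀ y)

theorem linInChart_apply (α : DForm I P 1 W) (p₀ : P) (y v : E) :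
    α.linInChart p₀ y v = α.inChart p₀ y ![v] := by
  change α.inChart p₀ y (fun _ ↦ v) = _
  congr 1
  ext i; fin_cases i; rfl

theorem linInChart_eval (α : DForm I P 1 W) (p₀ : P) (y v : E) :
    α.linInChart p₀ y v = α.eval ((extChartAt I p₀).symm y) ![chartSymmDeriv I p₀ y v] := by
  rw [linInChart_apply, inChart_eval]
  congr 1
  ext i; fin_cases i; rfl

theorem IsSmooth.contDiffAt [I.Boundaryless] {α : DForm I P k W} (hα : α.IsSmooth) {p₀ : P}
    {y : E} (hy : y ∈ (extChartAt I p₀).target) : ContDiffAt ℝ ∞ (α.inChart p₀) y :=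
  (hα p₀).contDiffAt (extChartAt_target_mem_nhds' hy)

theorem IsSmooth.differentiableAt [I.Boundaryless] {α : DForm I P k W} (hα : α.IsSmooth) {p₀ : P}
    {y : E} (hy : y ∈ (extChartAt I p₀).target) : DifferentiableAt ℝ (α.inChart p₀) y :=
  (hα.contDiffAt hy).differentiableAt (by simp)

variable [IsManifold I ∞ P] [I.Boundaryless]

/-- The exterior derivative may be computed in any chart. -/
theorem inChart_extDer {α : DForm I P k W} (hα : α.IsSmooth) {p₀ : P} {y : E}
    (hy : y ∈ (extChartAt I p₀).target) : α.extDer.inChart p₀ y = extDeriv (α.inChart p₀) y := by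
  set p := (extChartAt I p₀).symm y with hp
  -- `extDer` at `p` uses the preferred chart at `p`, so the comparison goes through this transition
  -- map and naturality of `extDeriv` under it.
  let τ : E → E := extChartAt I p ∘ (extChartAt I p₀).symm
  have hτy : τ y = extChartAt I p p := rfl
  have hsymm : ContMDiffAt 𝓘(ℝ, E) I ∞ (extChartAt I p₀).symm y :=
    (contMDiffOn_extChartAt_symm p₀).contMDiffAt (extChartAt_target_mem_nhds' hy)
  have hpsrc : ∀ᶠ x in 𝓝 y, (extChartAt I p₀).symm x ∈ (extChartAt I p).source :=
    hsymm.continuousAt (extChartAt_source_mem_nhds p)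
  have htgt : ∀ᶠ x in 𝓝 y, x ∈ (extChartAt I p₀).target := extChartAt_target_mem_nhds' hy
  have hsmooth : ∀ x ∈ (extChartAt I p₀).target,
      (extChartAt I p₀).symm x ∈ (extChartAt I p).source →
      ContMDiffAt 𝓘(ℝ, E) I ∞ (extChartAt I p₀).symm x ∧
      ContMDiffAt I 𝓘(ℝ, E) ∞ (extChartAt I p) ((extChartAt I p₀).symm x) := fun x hx hx' ↦
    ⟨(contMDiffOn_extChartAt_symm p₀).contMDiffAt (extChartAt_target_mem_nhds' hx),
      contMDiffAt_extChartAt' (by rwa [← extChartAt_source I])⟩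
  have hτ : ContDiffAt ℝ ∞ τ y := by
    obtain ⟨h1, h2⟩ := hsmooth y hy hpsrc.self_of_nhds
    exact (h2.comp y h1).contDiffAt
  have hDτ : ∀ x ∈ (extChartAt I p₀).target,
      (extChartAt I p₀).symm x ∈ (extChartAt I p).source → ∀ v,
      fderiv ℝ τ x v
        = chartDeriv I p ((extChartAt I p₀).symm x) (chartSymmDeriv I p₀ x v) := by
    intro x hx hx' v
    obtain ⟨h1, h2⟩ := hsmooth x hx hx'
    have h3 := mfderiv_comp x (h2.mdifferentiableAt (by simp)) (h1.mdifferentiableAt (by simp))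
    rw [chartSymmDeriv_eq_mfderiv, ← mfderiv_eq_fderiv]
    exact congrArg (fun L : E →L[ℝ] E ↦ L v) h3
  have hpull : α.inChart p₀ =ᶠ[𝓝 y]
      fun x ↦ (α.inChart p (τ x)).compContinuousLinearMap (fderiv ℝ τ x) := by
    filter_upwards [hpsrc, htgt] with x hx hx'
    have hinv : (extChartAt I p).symm (τ x) = (extChartAt I p₀).symm x :=
      (extChartAt I p).left_inv hx
    ext v
    rw [ContinuousAlternatingMap.compContinuousLinearMap_apply, inChart_eval, inChart_eval, hinv]
    congr 1
    ext i
    have hmem : τ x ∈ (extChartAt I p).target := (extChartAt I p).map_source hx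
    have h4 := chartSymmDeriv_chartDeriv hmem (chartSymmDeriv I p₀ x (v i))
    rw [hinv] at h4
    simp only [Function.comp_apply]
    rw [hDτ x hx' hx, h4]
  rw [hpull.extDeriv_eq, extDeriv_pullback (r := 2)
    (by rw [hτy]; exact hα.differentiableAt (mem_extChartAt_target p))
    (hτ.of_le (by norm_cast)) (by simp)]
  ext v
  rw [ContinuousAlternatingMap.compContinuousLinearMap_apply, inChart_eval, ← hp, extDer_eval, hτy]
  congr 1
  ext i
  exact (hDτ y hy hpsrc.self_of_nhds (v i)).symm

end DForm

/-! ### Vector fields and Lie brackets in charts -/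

section VectorFieldInChart

variable {E H : Type*} [NormedAddCommGroup E] [NormedSpace ℝ E] [TopologicalSpace H]
  {I : ModelWithCorners ℝ E H} {P : Type*} [TopologicalSpace P] [ChartedSpace H P]
  [IsManifold I ∞ P]

/-- A vector field in the chart around `p₀`. -/
def vectorFieldInChart (p₀ : P) (X : (p : P) → TangentSpace I p) : E → E :=
  VectorField.mpullbackWithin 𝓘(ℝ, E) I (extChartAt I p₀).symm X (range I)

theorem vectorFieldInChart_eq {p₀ : P} {y : E} (hy : y ∈ (extChartAt I p₀).target)
    (X : (p : P) → TangentSpace I p) {v : E}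
    (hv : chartSymmDeriv I p₀ y v = X ((extChartAt I p₀).symm y)) :
    vectorFieldInChart p₀ X y = v :=
  ((isInvertible_mfderivWithin_extChartAt_symm hy).inverse_apply_eq).2 hv.symm

theorem chartSymmDeriv_vectorFieldInChart {p₀ : P} {y : E}
    (hy : y ∈ (extChartAt I p₀).target) (X : (p : P) → TangentSpace I p) :
    chartSymmDeriv I p₀ y (vectorFieldInChart p₀ X y) = X ((extChartAt I p₀).symm y) :=
  (isInvertible_mfderivWithin_extChartAt_symm hy).self_apply_inverse _

theorem vectorFieldInChart_self (p : P) (X : (p : P) → TangentSpace I p) :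
    vectorFieldInChart p X (extChartAt I p p) = X p := by
  refine vectorFieldInChart_eq (mem_extChartAt_target p) X ?_
  refine (chartSymmDeriv_self p _).trans ?_
  exact congrArg (fun q ↦ (X q : E)) (extChartAt_to_inv p).symm

theorem differentiableAt_vectorFieldInChart [CompleteSpace E] [I.Boundaryless] {p : P}
    {X : (p : P) → TangentSpace I p}
    {U : Set P} (hU : IsOpen U)
    (hX : ContMDiffOn I I.tangent ∞ (fun p ↦ (⟨p, X p⟩ : TangentBundle I P)) U) (hp : p ∈ U) :
    DifferentiableAt ℝ (vectorFieldInChart p X) (extChartAt I p p) := by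
  have : IsManifold I 2 P := IsManifold.of_le (n := ∞) (by norm_cast)
  have h1 : MDifferentiableAt I I.tangent (fun p ↦ (⟨p, X p⟩ : TangentBundle I P)) p :=
    (hX.contMDiffAt (hU.mem_nhds hp)).mdifferentiableAt (by simp)
  have h2 : DifferentiableWithinAt ℝ (vectorFieldInChart p X)
      ((extChartAt I p).symm ⁻¹' univ ∩ range I) (extChartAt I p p) :=
    MDifferentiableWithinAt.differentiableWithinAt_mpullbackWithin_vectorField
      (mdifferentiableWithinAt_univ.2 h1)
  rwa [preimage_univ, univ_inter, I.range_eq_univ, differentiableWithinAt_univ] at h2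

theorem VectorField.mlieBracket_eq_inChart [I.Boundaryless] (p : P)
    (X Y : (p : P) → TangentSpace I p) :
    VectorField.mlieBracket I X Y p = VectorField.lieBracket ℝ (vectorFieldInChart p X)
      (vectorFieldInChart p Y) (extChartAt I p p) := by
  have h : VectorField.mlieBracket I X Y p = VectorField.lieBracketWithin ℝ
      (vectorFieldInChart p X) (vectorFieldInChart p Y)
      ((extChartAt I p).symm ⁻¹' univ ∩ range I) (extChartAt I p p) := by
    rw [← VectorField.mlieBracketWithin_univ, VectorField.mlieBracketWithin_apply,
      mfderiv_extChartAt_self]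
    exact congrArg (fun L : E →L[ℝ] E ↦ L _) ContinuousLinearMap.inverse_id
  rwa [preimage_univ, univ_inter, I.range_eq_univ, VectorField.lieBracketWithin_univ] at h

end VectorFieldInChart

/-! ### The action and the horizontal projection in charts -/

namespace PrincipalBundle

variable {E H : Type*} [NormedAddCommGroup E] [NormedSpace ℝ E] [TopologicalSpace H]
  {I : ModelWithCorners ℝ E H} {P : Type*} [TopologicalSpace P] [ChartedSpace H P]
  {EM HM : Type*} [NormedAddCommGroup EM] [NormedSpace ℝ EM] [TopologicalSpace HM]
  {IM : ModelWithCorners ℝ EM HM} {M : Type*} [TopologicalSpace M] [ChartedSpace HM M]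
  {EG HG : Type*} [NormedAddCommGroup EG] [NormedSpace ℝ EG] [TopologicalSpace HG]
  {IG : ModelWithCorners ℝ EG HG} {G : Type*} [TopologicalSpace G] [ChartedSpace HG G]
  [Group G] {k : ℕ} {W : Type*} [NormedAddCommGroup W] [NormedSpace ℝ W]

/-- The infinitesimal action, as a map between model spaces. -/
def fundamentalModel (B : PrincipalBundle I P IM M IG G) (p : P) : EG →L[ℝ] E := B.fundamental p

/-- The horizontal projection, as an endomorphism of the model space. -/
def horModel (B : PrincipalBundle I P IM M IG G) (η : DForm I P 1 EG) (p : P) : E →L[ℝ] E :=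
  B.horProj η p

theorem horModel_apply (B : PrincipalBundle I P IM M IG G) (η : DForm I P 1 EG) (p : P) (v : E) :
    B.horModel η p v = v - B.fundamentalModel p (η.eval p ![v]) := by
  rw [← DForm.toLin_eval]
  rfl

theorem covExtDer_eval (B : PrincipalBundle I P IM M IG G) (η : DForm I P 1 EG)
    (α : DForm I P k W) (p : P) (v : Fin (k + 1) → E) :
    (B.covExtDer η α).eval p v = α.extDer.eval p (fun i ↦ B.horModel η p (v i)) := rfl

/-- The principal action in the chart around `p₀` and in the chart of the group around `1`. -/
def actInChart (B : PrincipalBundle I P IM M IG G) (p₀ : P) (x : E × EG) : E :=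
  extChartAt I p₀ (B.act ((extChartAt I p₀).symm x.1) ((extChartAt IG (1 : G)).symm x.2))

/-- The infinitesimal action in the chart around `p₀`. -/
def fundamentalInChart (B : PrincipalBundle I P IM M IG G) (p₀ : P) (y : E) : EG →L[ℝ] E :=
  (fderiv ℝ (B.actInChart p₀) (y, extChartAt IG (1 : G) 1)).comp (ContinuousLinearMap.inr ℝ E EG)

/-- The horizontal projection in the chart around `p₀`. -/
def horInChart (B : PrincipalBundle I P IM M IG G) (η : DForm I P 1 EG) (p₀ : P) (y : E) :
    E →L[ℝ] E :=
  ContinuousLinearMap.id ℝ E - (B.fundamentalInChart p₀ y).comp (η.linInChart p₀ y)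

theorem horInChart_apply (B : PrincipalBundle I P IM M IG G) (η : DForm I P 1 EG) (p₀ : P)
    (y v : E) :
    B.horInChart η p₀ y v = v - B.fundamentalInChart p₀ y (η.linInChart p₀ y v) := rfl

variable [IsManifold I ∞ P] [I.Boundaryless] [IG.Boundaryless] [LieGroup IG ∞ G]
  (B : PrincipalBundle I P IM M IG G) {η : DForm I P 1 EG} {p₀ : P} {y : E}

omit [IsManifold I ∞ P] [I.Boundaryless] [IG.Boundaryless] [LieGroup IG ∞ G] in
theorem actInChart_one (hy : y ∈ (extChartAt I p₀).target) :
    B.actInChart p₀ (y, extChartAt IG (1 : G) 1) = y := by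
  simp only [actInChart, extChartAt_to_inv, B.act_one]
  exact (extChartAt I p₀).right_inv hy

/-- The action in charts is smooth wherever it is defined. -/
theorem contDiffAt_actInChart {z : EG} (hy : y ∈ (extChartAt I p₀).target)
    (hz : z ∈ (extChartAt IG (1 : G)).target)
    (hyz : B.act ((extChartAt I p₀).symm y) ((extChartAt IG (1 : G)).symm z)
      ∈ (extChartAt I p₀).source) :
    ContDiffAt ℝ ∞ (B.actInChart p₀) (y, z) := by
  have : IsManifold IG ∞ G := inferInstance
  have h1 : ContMDiffAt 𝓘(ℝ, E × EG) I ∞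
      (fun x : E × EG ↦ (extChartAt I p₀).symm x.1) (y, z) :=
    ((contMDiffOn_extChartAt_symm p₀).contMDiffAt
      (extChartAt_target_mem_nhds' hy)).comp (y, z) contDiff_fst.contMDiff.contMDiffAt
  have h2 : ContMDiffAt 𝓘(ℝ, E × EG) IG ∞
      (fun x : E × EG ↦ (extChartAt IG (1 : G)).symm x.2) (y, z) :=
    ((contMDiffOn_extChartAt_symm (1 : G)).contMDiffAt
      (extChartAt_target_mem_nhds' hz)).comp (y, z) contDiff_snd.contMDiff.contMDiffAt
  have h3 := B.contMDiff_act.contMDiffAt.comp (y, z) (h1.prodMk h2)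
  have h4 : ContMDiffAt I 𝓘(ℝ, E) ∞ (extChartAt I p₀)
      (B.act ((extChartAt I p₀).symm y) ((extChartAt IG (1 : G)).symm z)) :=
    contMDiffAt_extChartAt' (by rwa [← extChartAt_source I])
  exact (h4.comp (y, z) h3).contDiffAt

theorem contDiffAt_actInChart_one (hy : y ∈ (extChartAt I p₀).target) :
    ContDiffAt ℝ ∞ (B.actInChart p₀) (y, extChartAt IG (1 : G) 1) := by
  refine B.contDiffAt_actInChart hy (mem_extChartAt_target 1) ?_
  rw [extChartAt_to_inv, B.act_one]
  exact (extChartAt I p₀).map_target hy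

/-- Chain rule; the chart of `G` leaves no factor because its derivative at `1` is the identity. -/
theorem fundamentalInChart_apply (hy : y ∈ (extChartAt I p₀).target) (Z : EG) :
    B.fundamentalInChart p₀ y Z = chartDeriv I p₀ ((extChartAt I p₀).symm y)
      (B.fundamentalModel ((extChartAt I p₀).symm y) Z) := by
  have : IsManifold IG ∞ G := inferInstance
  set p := (extChartAt I p₀).symm y with hp
  set z := extChartAt IG (1 : G) 1 with hz
  have hz1 : (extChartAt IG (1 : G)).symm z = 1 := extChartAt_to_inv 1
  have hpsrc : p ∈ (extChartAt I p₀).source := (extChartAt I p₀).map_target hy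
  have hd := ((B.contDiffAt_actInChart_one hy).differentiableAt (by simp)).hasFDerivAt.comp
    (f := fun e ↦ (y, e)) z (hasFDerivAt_prodMk_right y z)
  have h1 : MDifferentiableAt 𝓘(ℝ, EG) IG (extChartAt IG (1 : G)).symm z :=
    ((contMDiffOn_extChartAt_symm (n := ∞) (1 : G)).contMDiffAt
      (extChartAt_target_mem_nhds' (mem_extChartAt_target 1))).mdifferentiableAt (by simp)
  have h2 : MDifferentiableAt IG I (B.act p) ((extChartAt IG (1 : G)).symm z) :=
    (B.contMDiff_act.comp (contMDiff_const.prodMk contMDiff_id)).mdifferentiableAt (by simp)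
  have h3 : MDifferentiableAt I 𝓘(ℝ, E) (extChartAt I p₀)
      (B.act p ((extChartAt IG (1 : G)).symm z)) := by
    rw [hz1, B.act_one]
    exact mdifferentiableAt_extChartAt (by rwa [← extChartAt_source I])
  have h4 := mfderiv_comp z h3 (h2.comp z h1)
  have h5 := mfderiv_comp z h2 h1
  have h6 : fderiv ℝ (fun e ↦ B.actInChart p₀ (y, e)) z Z
      = chartDeriv I p₀ (B.act p ((extChartAt IG (1 : G)).symm z))
        ((mfderiv IG I (B.act p) ((extChartAt IG (1 : G)).symm z) : EG →L[ℝ] E)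
          (chartSymmDeriv IG (1 : G) z Z)) := by
    rw [chartSymmDeriv_eq_mfderiv, ← mfderiv_eq_fderiv]
    refine (congrArg (fun L : EG →L[ℝ] E ↦ L Z) h4).trans ?_
    exact congrArg (fun L : EG →L[ℝ] E ↦
      chartDeriv I p₀ (B.act p ((extChartAt IG (1 : G)).symm z)) (L Z)) h5
  have h7 : B.fundamentalInChart p₀ y Z = fderiv ℝ (fun e ↦ B.actInChart p₀ (y, e)) z Z :=
    congrArg (fun L : EG →L[ℝ] E ↦ L Z) hd.fderiv.symm
  rw [h7, h6, chartSymmDeriv_self, hz1, B.act_one]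
  rfl

/-- Stated for group elements near `1` and not only at `1`, because equivariance of the connection
is differentiated in the group variable. -/
theorem fderiv_actInChart_translate {z : EG} (hy : y ∈ (extChartAt I p₀).target)
    (hz : z ∈ (extChartAt IG (1 : G)).target)
    (hyz : B.act ((extChartAt I p₀).symm y) ((extChartAt IG (1 : G)).symm z)
      ∈ (extChartAt I p₀).source) (v : E) :
    fderiv ℝ (B.actInChart p₀) (y, z) (v, 0) =
      chartDeriv I p₀ (B.act ((extChartAt I p₀).symm y) ((extChartAt IG (1 : G)).symm z))
        ((mfderiv I I (fun q ↦ B.act q ((extChartAt IG (1 : G)).symm z))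
          ((extChartAt I p₀).symm y) : E →L[ℝ] E) (chartSymmDeriv I p₀ y v)) := by
  set g := (extChartAt IG (1 : G)).symm z with hg
  have hd := ((B.contDiffAt_actInChart hy hz hyz).differentiableAt (by simp)).hasFDerivAt.comp
    (f := fun e ↦ (e, z)) y (hasFDerivAt_prodMk_left y z)
  have h1 : MDifferentiableAt 𝓘(ℝ, E) I (extChartAt I p₀).symm y :=
    ((contMDiffOn_extChartAt_symm (n := ∞) p₀).contMDiffAt
      (extChartAt_target_mem_nhds' hy)).mdifferentiableAt (by simp)
  have h2 : MDifferentiableAt I I (fun q ↦ B.act q g) ((extChartAt I p₀).symm y) :=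
    (B.contMDiff_act.comp (contMDiff_id.prodMk contMDiff_const)).mdifferentiableAt (by simp)
  have h3 : MDifferentiableAt I 𝓘(ℝ, E) (extChartAt I p₀)
      (B.act ((extChartAt I p₀).symm y) g) :=
    mdifferentiableAt_extChartAt (by rwa [← extChartAt_source I])
  have h4 := mfderiv_comp y (f := (fun q ↦ B.act q g) ∘ (extChartAt I p₀).symm) h3 (h2.comp y h1)
  have h5 := mfderiv_comp y h2 h1
  have h7 : fderiv ℝ (B.actInChart p₀) (y, z) (v, 0)
      = fderiv ℝ (fun e ↦ B.actInChart p₀ (e, z)) y v :=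
    congrArg (fun L : E →L[ℝ] E ↦ L v) hd.fderiv.symm
  rw [h7, chartSymmDeriv_eq_mfderiv, ← mfderiv_eq_fderiv]
  refine (congrArg (fun L : E →L[ℝ] E ↦ L v) h4).trans ?_
  exact congrArg (fun L : E →L[ℝ] E ↦
    chartDeriv I p₀ (B.act ((extChartAt I p₀).symm y) g) (L v)) h5

theorem chartSymmDeriv_fundamentalInChart (hy : y ∈ (extChartAt I p₀).target) (Z : EG) :
    chartSymmDeriv I p₀ y (B.fundamentalInChart p₀ y Z)
      = B.fundamentalModel ((extChartAt I p₀).symm y) Z := by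
  rw [B.fundamentalInChart_apply hy, chartSymmDeriv_chartDeriv hy]

theorem chartSymmDeriv_horInChart (hy : y ∈ (extChartAt I p₀).target) (v : E) :
    chartSymmDeriv I p₀ y (B.horInChart η p₀ y v)
      = B.horModel η ((extChartAt I p₀).symm y) (chartSymmDeriv I p₀ y v) := by
  rw [horInChart_apply, map_sub, B.chartSymmDeriv_fundamentalInChart hy, DForm.linInChart_eval,
    horModel_apply]

/-- The infinitesimal action is a partial derivative of the jointly smooth action, hence smooth in
the base point. -/
theorem contDiffOn_fundamentalInChart :
    ContDiffOn ℝ ∞ (B.fundamentalInChart p₀) (extChartAt I p₀).target := by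
  intro x hx
  refine ContDiffAt.contDiffWithinAt ?_
  have h1 : ContDiffAt ℝ ∞ (fderiv ℝ (B.actInChart p₀)) (x, extChartAt IG (1 : G) 1) :=
    (B.contDiffAt_actInChart_one hx).fderiv_right (by simp)
  have h2 : ContDiffAt ℝ ∞ (fun e : E ↦ (e, extChartAt IG (1 : G) 1)) x :=
    contDiffAt_id.prodMk contDiffAt_const
  exact (h1.comp x h2).clm_comp contDiffAt_const

theorem contDiffOn_horInChart (hη : η.IsSmooth) :
    ContDiffOn ℝ ∞ (B.horInChart η p₀) (extChartAt I p₀).target := by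
  refine contDiffOn_const.sub (B.contDiffOn_fundamentalInChart.clm_comp ?_)
  exact (ContinuousAlternatingMap.ofSubsingletonLIE (𝕜 := ℝ) (E := E) (F := EG)
    (0 : Fin 1)).symm.contDiff.comp_contDiffOn (hη p₀)

omit [I.Boundaryless] [IG.Boundaryless] [IsManifold I ∞ P] [LieGroup IG ∞ G] in
theorem IsPrincipalConnection.eval_fundamentalModel (hη : B.IsPrincipalConnection η) (p : P)
    (Z : EG) : η.eval p ![B.fundamentalModel p Z] = Z := by
  rw [← DForm.toLin_eval]
  exact hη.reproduces p Z

/-! ### Principal connections in charts and the Bianchi identity -/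

variable {B}

theorem IsPrincipalConnection.linInChart_fundamentalInChart (hη : B.IsPrincipalConnection η)
    (hy : y ∈ (extChartAt I p₀).target) (Z : EG) :
    η.linInChart p₀ y (B.fundamentalInChart p₀ y Z) = Z := by
  rw [DForm.linInChart_eval, B.chartSymmDeriv_fundamentalInChart hy,
    hη.eval_fundamentalModel]

theorem IsPrincipalConnection.linInChart_horInChart (hη : B.IsPrincipalConnection η)
    (hy : y ∈ (extChartAt I p₀).target) (v : E) :
    η.linInChart p₀ y (B.horInChart η p₀ y v) = 0 := by
  rw [horInChart_apply, map_sub, hη.linInChart_fundamentalInChart hy, sub_self]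

theorem IsPrincipalConnection.horInChart_horInChart (hη : B.IsPrincipalConnection η)
    (hy : y ∈ (extChartAt I p₀).target) (v : E) :
    B.horInChart η p₀ y (B.horInChart η p₀ y v) = B.horInChart η p₀ y v := by
  rw [horInChart_apply, hη.linInChart_horInChart hy, map_zero, sub_zero]

/-- The exterior derivative of a principal connection vanishes on a vertical and a horizontal
vector. -/
theorem IsPrincipalConnection.extDeriv_vertical_horizontal (hη : B.IsPrincipalConnection η)
    (hy : y ∈ (extChartAt I p₀).target) (Z : EG) {v : E} (hv : η.linInChart p₀ y v = 0) :
    extDeriv (η.inChart p₀) y ![B.fundamentalInChart p₀ y Z, v] = 0 := by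
  refine extDeriv_orbit_eq_zero (A := B.actInChart p₀) (z := extChartAt IG (1 : G) 1) (c := Z)
    (hη.smooth.differentiableAt hy) (B.contDiffAt_actInChart_one hy) ?_ ?_ ?_
  · filter_upwards [extChartAt_target_mem_nhds' hy] with x hx
    exact B.actInChart_one hx
  · filter_upwards [extChartAt_target_mem_nhds' hy] with x hx
    have h := hη.linInChart_fundamentalInChart hx Z
    rwa [DForm.linInChart_apply] at h
  · have hcont : ContinuousAt (fun w ↦ B.act ((extChartAt I p₀).symm y)
        ((extChartAt IG (1 : G)).symm w)) (extChartAt IG (1 : G) 1) := by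
      have hc : Continuous (B.act ((extChartAt I p₀).symm y)) :=
        B.contMDiff_act.continuous.comp (continuous_const.prodMk continuous_id)
      exact hc.continuousAt.comp (continuousAt_extChartAt_symm (1 : G))
    -- For group elements close to `1` the translated point stays in the chart around `p₀`.
    have hsrc : ∀ᶠ w in 𝓝 (extChartAt IG (1 : G) 1), B.act ((extChartAt I p₀).symm y)
        ((extChartAt IG (1 : G)).symm w) ∈ (extChartAt I p₀).source := by
      refine hcont.eventually_mem ?_
      rw [extChartAt_to_inv, B.act_one]
      exact (isOpen_extChartAt_source p₀).mem_nhds ((extChartAt I p₀).map_target hy)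
    filter_upwards [hsrc, extChartAt_target_mem_nhds (I := IG) (1 : G)] with w hw hw'
    have hmem : B.actInChart p₀ (y, w) ∈ (extChartAt I p₀).target :=
      (extChartAt I p₀).map_source hw
    have hinv : (extChartAt I p₀).symm (B.actInChart p₀ (y, w)) =
        B.act ((extChartAt I p₀).symm y) ((extChartAt IG (1 : G)).symm w) :=
      (extChartAt I p₀).left_inv hw
    have h1 := chartSymmDeriv_chartDeriv (I := I) hmem
      ((mfderiv I I (fun q ↦ B.act q ((extChartAt IG (1 : G)).symm w))
          ((extChartAt I p₀).symm y) : E →L[ℝ] E) (chartSymmDeriv I p₀ y v))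
    rw [hinv] at h1
    rw [← DForm.linInChart_apply, B.fderiv_actInChart_translate hy hw' hw, DForm.linInChart_eval,
      hinv, h1]
    -- `η(Tρ_g v) = Ad(g⁻¹)(η v) = 0`: translates of a horizontal vector stay horizontal, and only
    -- linearity of `Ad` is used.
    refine ((DForm.toLin_eval _ _ _).symm.trans (hη.equivariant _ _ _)).trans ?_
    rw [DForm.linInChart_eval, ← DForm.toLin_eval] at hv
    exact (congrArg (lieAd IG ((extChartAt IG (1 : G)).symm w)⁻¹) hv).trans (map_zero _)

/-- The curvature `d^η η` in a chart. -/
theorem IsPrincipalConnection.inChart_covExtDer (hη : B.IsPrincipalConnection η)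
    (hy : y ∈ (extChartAt I p₀).target) :
    (B.covExtDer η η).inChart p₀ y =
      (extDeriv (η.inChart p₀) y).compContinuousLinearMap (B.horInChart η p₀ y) := by
  ext v
  rw [DForm.inChart_eval, covExtDer_eval, ← DForm.inChart_extDer hη.smooth hy,
    ContinuousAlternatingMap.compContinuousLinearMap_apply, DForm.inChart_eval]
  congr 1
  ext i
  exact (B.chartSymmDeriv_horInChart hy (v i)).symm

theorem IsPrincipalConnection.isSmooth_covExtDer (hη : B.IsPrincipalConnection η) :
    (B.covExtDer η η).IsSmooth := fun p₀ ↦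
  ((contDiffOn_extDeriv (isOpen_extChartAt_target p₀)
    (hη.smooth p₀)).continuousAlternatingMap_compContinuousLinearMap
      (B.contDiffOn_horInChart hη.smooth)).congr fun _ hy ↦ hη.inChart_covExtDer hy

/-- The Bianchi identity. -/
theorem IsPrincipalConnection.covExtDer_covExtDer (hη : B.IsPrincipalConnection η) :
    B.covExtDer η (B.covExtDer η η) = 0 := by
  have key : ∀ (p : P) (v : Fin 3 → E), (B.covExtDer η (B.covExtDer η η)).eval p v = 0 := by
    intro p v
    set y := extChartAt I p p with hydef
    have hy : y ∈ (extChartAt I p).target := mem_extChartAt_target p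
    have htgt : ∀ᶠ x in 𝓝 y, x ∈ (extChartAt I p).target := extChartAt_target_mem_nhds' hy
    have hhor : ∀ u, chartDeriv I p p (B.horModel η p u) = B.horInChart η p y u := by
      intro u
      have h := B.chartSymmDeriv_horInChart (η := η) hy u
      rw [chartSymmDeriv_self, chartSymmDeriv_self, extChartAt_to_inv] at h
      rw [chartDeriv_self, h]
    have hzero := extDeriv_compContinuousLinearMap_projection_eq_zero (y := y)
      (Θ := extDeriv (η.inChart p)) (h := B.horInChart η p)
      (((contDiffOn_extDeriv (isOpen_extChartAt_target p) (hη.smooth p)).contDiffAt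
        (extChartAt_target_mem_nhds' hy)).differentiableAt (by simp))
      (((B.contDiffOn_horInChart hη.smooth).contDiffAt
        (extChartAt_target_mem_nhds' hy)).differentiableAt (by simp))
      (extDeriv_extDeriv_apply (r := 2) ((hη.smooth.contDiffAt hy).of_le (by norm_cast)) (by simp))
      (htgt.mono fun x hx ↦ hη.horInChart_horInChart hx) (by
        intro i w hi hj
        -- A vector in the kernel of `P_H` equals its vertical part, so it is the value of a
        -- generator.
        have hvert : w i = B.fundamentalInChart p y (η.linInChart p y (w i)) := by
          rwa [horInChart_apply, sub_eq_zero] at hi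
        have hhor' : ∀ j ≠ i, η.linInChart p y (w j) = 0 := fun j hji ↦ by
          rw [← hj j hji]
          exact hη.linInChart_horInChart hy _
        have hw : w = ![w 0, w 1] := by ext j; fin_cases j <;> rfl
        fin_cases i
        · rw [hw]
          have h := hη.extDeriv_vertical_horizontal hy (η.linInChart p y (w 0))
            (hhor' 1 (by simp))
          have hvert' : w 0 = B.fundamentalInChart p y (η.linInChart p y (w 0)) := hvert
          rwa [← hvert'] at h
        · have h := hη.extDeriv_vertical_horizontal hy (η.linInChart p y (w 1))
            (hhor' 0 (by simp))
          have hvert' : w 1 = B.fundamentalInChart p y (η.linInChart p y (w 1)) := hvert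
          rw [← hvert'] at h
          -- The vertical vector is in the second slot here; antisymmetry reduces to the first.
          have hswap := (extDeriv (η.inChart p) y).map_swap w (i := 0) (j := 1) (by simp)
          have hw' : w ∘ Equiv.swap (0 : Fin 2) 1 = ![w 1, w 0] := by
            ext j; fin_cases j <;> simp
          rw [hw'] at hswap
          exact neg_eq_zero.1 (hswap.symm.trans h))
    rw [covExtDer_eval, DForm.extDer_eval,
      Filter.EventuallyEq.extDeriv_eq (htgt.mono fun x hx ↦ hη.inChart_covExtDer hx)]
    simp only [hhor]
    exact congrArg (fun τ ↦ τ v) hzero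
  funext p
  exact ContinuousAlternatingMap.ext (key p)

end PrincipalBundle

/-! ### Existence and uniqueness of the curvature form -/

namespace PrincipalBundle

variable {E H : Type*} [NormedAddCommGroup E] [NormedSpace ℝ E] [TopologicalSpace H]
  {I : ModelWithCorners ℝ E H} {P : Type*} [TopologicalSpace P] [ChartedSpace H P]
  {EM HM : Type*} [NormedAddCommGroup EM] [NormedSpace ℝ EM] [TopologicalSpace HM]
  {IM : ModelWithCorners ℝ EM HM} {M : Type*} [TopologicalSpace M] [ChartedSpace HM M]
  {EG HG : Type*} [NormedAddCommGroup EG] [NormedSpace ℝ EG] [TopologicalSpace HG]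
  {IG : ModelWithCorners ℝ EG HG} {G : Type*} [TopologicalSpace G] [ChartedSpace HG G]
  [Group G] {B : PrincipalBundle I P IM M IG G} {η : DForm I P 1 EG} [IsManifold I ∞ P]

/-- A curvature form is determined by its defining property. -/
theorem IsCurvatureForm.unique (hη : B.IsPrincipalConnection η) {Ω Ω' : DForm I P 2 EG}
    (hΩ : B.IsCurvatureForm η Ω) (hΩ' : B.IsCurvatureForm η Ω') : Ω = Ω' := by
  funext p
  ext v
  have hinj : Function.Injective (B.fundamental p) :=
    Function.LeftInverse.injective (g := η.toLin p) (hη.reproduces p)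
  -- The tangent bundle costs one derivative, which is harmless because `∞ + 1` is `∞`.
  have : IsManifold I (∞ + 1) P := ‹IsManifold I ∞ P›
  have : ContMDiffVectorBundle ∞ E (TangentSpace I : P → Type _) I :=
    TangentBundle.contMDiffVectorBundle
  -- The defining property speaks of fields, so the two vectors at `p` are extended to smooth fields
  -- on a common neighbourhood.
  obtain ⟨s, hs, hX⟩ := FiberBundle.exists_contMDiffOn_extend (k := ∞) I E (v 0)
  obtain ⟨t, ht, hY⟩ := FiberBundle.exists_contMDiffOn_extend (k := ∞) I E (v 1)
  obtain ⟨U, hU, hUo, hpU⟩ := mem_nhds_iff.1 (Filter.inter_mem hs ht)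
  have h := hΩ.2 U hUo _ _ (hX.mono (hU.trans inter_subset_left))
    (hY.mono (hU.trans inter_subset_right)) p hpU
  have h' := hΩ'.2 U hUo _ _ (hX.mono (hU.trans inter_subset_left))
    (hY.mono (hU.trans inter_subset_right)) p hpU
  have hv : v = ![FiberBundle.extend E (v 0) p, FiberBundle.extend E (v 1) p] := by
    rw [FiberBundle.extend_apply_self, FiberBundle.extend_apply_self]
    ext i; fin_cases i <;> rfl
  rw [hv]
  exact hinj (h.trans h'.symm)

variable [CompleteSpace E] [I.Boundaryless] [IG.Boundaryless] [LieGroup IG ∞ G]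

/-- `d^η η` is the curvature form of the principal connection `η`. -/
theorem IsPrincipalConnection.isCurvatureForm_covExtDer (hη : B.IsPrincipalConnection η) :
    B.IsCurvatureForm η (B.covExtDer η η) := by
  refine ⟨hη.isSmooth_covExtDer, fun U hU X Y hX hY p hp ↦ ?_⟩
  set y := extChartAt I p p with hydef
  have hy : y ∈ (extChartAt I p).target := mem_extChartAt_target p
  have htgt : ∀ᶠ x in 𝓝 y, x ∈ (extChartAt I p).target := extChartAt_target_mem_nhds' hy
  have hhor : ∀ Z : (p : P) → TangentSpace I p, ∀ x ∈ (extChartAt I p).target,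
      vectorFieldInChart p (fun q ↦ B.horProj η q (Z q)) x
        = B.horInChart η p x (vectorFieldInChart p Z x) := by
    intro Z x hx
    refine vectorFieldInChart_eq hx _ ?_
    rw [B.chartSymmDeriv_horInChart hx, chartSymmDeriv_vectorFieldInChart hx]
    rfl
  have hdiff : ∀ Z : (p : P) → TangentSpace I p,
      ContMDiffOn I I.tangent ∞ (fun p ↦ (⟨p, Z p⟩ : TangentBundle I P)) U →
      DifferentiableAt ℝ (vectorFieldInChart p (fun q ↦ B.horProj η q (Z q))) y := by
    intro Z hZ
    refine DifferentiableAt.congr_of_eventuallyEq ?_ (htgt.mono fun x hx ↦ hhor Z x hx)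
    exact (((B.contDiffOn_horInChart hη.smooth).contDiffAt
      (extChartAt_target_mem_nhds' hy)).differentiableAt (by simp)).clm_apply
        (differentiableAt_vectorFieldInChart hU hZ hp)
  have hker : ∀ Z : (p : P) → TangentSpace I p, ∀ᶠ x in 𝓝 y,
      η.inChart p x ![vectorFieldInChart p (fun q ↦ B.horProj η q (Z q)) x] = 0 := by
    intro Z
    filter_upwards [htgt] with x hx
    rw [← DForm.linInChart_apply, hhor Z x hx, hη.linInChart_horInChart hx]
  have key := extDeriv_eq_neg_lieBracket_of_ker (hη.smooth.differentiableAt hy) (hdiff X hX)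
    (hdiff Y hY) (hker X) (hker Y)
  rw [DForm.inChart_self_eval, ← VectorField.mlieBracket_eq_inChart,
    ← DForm.inChart_extDer hη.smooth hy, DForm.inChart_self_eval, vectorFieldInChart_self,
    vectorFieldInChart_self] at key
  have hΩ : (B.covExtDer η η).eval p ![X p, Y p]
      = η.extDer.eval p ![B.horProj η p (X p), B.horProj η p (Y p)] := by
    rw [covExtDer_eval]
    congr 1
    ext i; fin_cases i <;> rfl
  -- Applying `ζ_p` turns `-η([P_H X, P_H Y])` into `-P_V([P_H X, P_H Y])`.
  have h := congrArg (B.fundamentalModel p) (hΩ.trans key)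
  rw [map_neg] at h
  refine h.trans (congrArg Neg.neg ?_)
  exact congrArg (B.fundamentalModel p) (DForm.toLin_eval η p _).symm

end PrincipalBundle

end

theorem mainTheorem8
    {E H : Type*} [NormedAddCommGroup E] [NormedSpace ℝ E] [FiniteDimensional ℝ E]
    [TopologicalSpace H] (I : ModelWithCorners ℝ E H) [I.Boundaryless]
    {EM HM : Type*} [NormedAddCommGroup EM] [NormedSpace ℝ EM] [FiniteDimensional ℝ EM]
    [TopologicalSpace HM] (IM : ModelWithCorners ℝ EM HM) [IM.Boundaryless]
    {EG HG : Type*} [NormedAddCommGroup EG] [NormedSpace ℝ EG] [FiniteDimensional ℝ EG]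
    [TopologicalSpace HG] (IG : ModelWithCorners ℝ EG HG) [IG.Boundaryless]
    (P : Type*) [TopologicalSpace P] [ChartedSpace H P] [IsManifold I ∞ P]
    (M : Type*) [TopologicalSpace M] [ChartedSpace HM M] [IsManifold IM ∞ M]
    (G : Type*) [TopologicalSpace G] [ChartedSpace HG G] [Group G] [LieGroup IG ∞ G]
    (B : PrincipalBundle I P IM M IG G)
    (η : DForm I P 1 EG) (hη : B.IsPrincipalConnection η) :
    (∃! Ω : DForm I P 2 EG, B.IsCurvatureForm η Ω) ∧
      ∀ Ω : DForm I P 2 EG, B.IsCurvatureForm η Ω → B.covExtDer η Ω = 0 := by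
  have : CompleteSpace E := FiniteDimensional.complete ℝ E
  have hcurv := hη.isCurvatureForm_covExtDer
  refine ⟨⟨_, hcurv, fun Ω hΩ ↦ hΩ.unique hη hcurv⟩, fun Ω hΩ ↦ ?_⟩
  rw [hΩ.unique hη hcurv]
  exact hη.covExtDer_covExtDer
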